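/- Let $\mathbb{N}=\{1,2,\dots\}$. Let $s(n,k)$, $n\ge k\ge 0$, be the (signed) Stirling numbers of the first kind, generated by $$\frac{[\ln(1+x)]^k}{k!}=\sum_{n=k}^\infty s(n,k)\frac{x^n}{n!},\qquad |x|<1 .$$ For $k\in\mathbb{N}$ and $m\ge 2$ put $$Q(k,m)=\sum_{\ell=0}^{m}\binom{k+\ell-1}{k-1}\,s(k+m-1,k+\ell-1)\left(\frac{k+m-2}{2}\right)^{\ell},$$ and let $\langle\beta\rangle_j=\prod_{i=0}^{j-1}(\beta-i)$ denote the falling factorial. Then for all $k,n\in\mathbb{N}$, $$\sum_{j=1}^{n}(-1)^j\,\frac{\langle k\rangle_j}{j!}\sum_{\ell=1}^{j}(-1)^\ell\,(2\ell)!\binom{j}{\ell}\frac{Q(2\ell,2n)}{(2\ell+2n)!}=(2k)!\,\frac{Q(2k,2n)}{(2k+2n)!}.$$ -/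

import Mathlib

/-- The (signed) Stirling number of the first kind `s(n, k)`: Mathlib's unsigned number
`Nat.stirlingFirst n k` with the sign `(-1)^(n-k) = (-1)^(n+k)`; it vanishes for `n < k`. -/
def signedStirlingFirst (n k : ℕ) : ℤ :=
  (-1) ^ (n + k) * (Nat.stirlingFirst n k : ℤ)

/-- The numbers `s(n, k)` are the ones generated by
`[ln(1+x)]^k / k! = ∑_{n ≥ k} s(n, k) x^n / n!` (`PowerSeries.log ℚ` is the series of `ln(1+x)`);
the terms with `n < k` are zero. -/
theorem signedStirlingFirst_generating (k : ℕ) :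
    PowerSeries.C ((1 : ℚ) / (k.factorial : ℚ)) * PowerSeries.log ℚ ^ k =
      PowerSeries.mk fun n => (signedStirlingFirst n k : ℚ) / (n.factorial : ℚ) := by
  have hlog : (1 + PowerSeries.X) * PowerSeries.derivative ℚ (PowerSeries.log ℚ) = 1 := by
    rw [PowerSeries.deriv_log]
    ext n
    cases n with
    | zero => simp
    | succ n =>
      rw [add_mul, one_mul, map_add, PowerSeries.coeff_succ_X_mul]
      simp [PowerSeries.coeff_one, pow_succ]
  have hunit : (1 + PowerSeries.X : PowerSeries ℚ) ≠ 0 := by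
    intro h
    have := congrArg PowerSeries.constantCoeff h
    simp at this
  induction k with
  | zero =>
    ext n
    cases n <;> simp [signedStirlingFirst, PowerSeries.coeff_one]
  | succ k ih =>
    refine PowerSeries.derivative.ext (mul_left_cancel₀ hunit ?_) ?_
    · trans PowerSeries.C ((1 : ℚ) / (k.factorial : ℚ)) * PowerSeries.log ℚ ^ k
      · have hc : (PowerSeries.C ((1 : ℚ) / ((k + 1).factorial : ℚ)) : PowerSeries ℚ) * (k + 1) =
            PowerSeries.C ((1 : ℚ) / (k.factorial : ℚ)) := by
          have h1 : ((k : PowerSeries ℚ) + 1) = PowerSeries.C ((k : ℚ) + 1) := by simp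
          rw [h1, ← map_mul, Nat.factorial_succ]
          congr 1
          push_cast
          field_simp
        rw [Derivation.leibniz, PowerSeries.derivative_C, PowerSeries.derivative_pow, ← hc]
        simp only [smul_eq_mul, mul_zero, add_zero, Nat.add_sub_cancel]
        push_cast
        linear_combination (PowerSeries.C ((1 : ℚ) / ((k + 1).factorial : ℚ)) * (k + 1) *
          PowerSeries.log ℚ ^ k) * hlog
      · rw [ih]
        ext n
        cases n with
        | zero =>
          rw [add_mul, one_mul, map_add, PowerSeries.coeff_derivative]
          have hs : (-1 : ℚ) ^ (1 + (k + 1)) = (-1) ^ k := by ring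
          simp [signedStirlingFirst, Nat.stirlingFirst_succ_succ, hs]
        | succ n =>
          rw [add_mul, one_mul, map_add, PowerSeries.coeff_succ_X_mul,
            PowerSeries.coeff_derivative, PowerSeries.coeff_derivative]
          simp only [PowerSeries.coeff_mk, signedStirlingFirst,
            Nat.stirlingFirst_succ_succ (n + 1) k, Nat.factorial_succ]
          push_cast
          have : (n.factorial : ℚ) ≠ 0 := by positivity
          field_simp
          ring
    · simp [signedStirlingFirst]

/-- `Q(k, m) = ∑_{ℓ=0}^{m} C(k+ℓ-1, k-1) s(k+m-1, k+ℓ-1) ((k+m-2)/2)^ℓ`, for `k ≥ 1`, `m ≥ 2`.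
In this range none of the natural number subtractions truncates. -/
def Q (k m : ℕ) : ℚ :=
  ∑ l ∈ Finset.range (m + 1),
    ((k + l - 1).choose (k - 1) : ℚ) * (signedStirlingFirst (k + m - 1) (k + l - 1) : ℚ) *
      (((k : ℚ) + (m : ℚ) - 2) / 2) ^ l

/-! Let S(y) = (2 arcsinh(√y/2))² and f = S/y, so f(0) = 1. The quantity (2k)! Q(2k,2n)/(2k+2n)! is
the coefficient of y^n in f^k (`Q_even_eq_coeff_arsinhSqDiv_pow`). Write f^k = (1 - (1 - f))^k:
since (1 - f)^j has order at least j, only j ≤ n matter, and expanding (1 - f)^j in powers of f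
gives the double sum (`coeff_pow_eq_newton`). For the coefficient formula, recentring a falling
factorial at the midpoint of its roots turns Q(2k,2n) into a coefficient of ∏ (u - i²). These
coefficients obey the recurrence that d²/dh² h^(2k) = 2k(2k-1) h^(2k-2) imposes on the powers of S =
h². -/

open Polynomial in
/-- The generating polynomial `∑ s(N, r) X^r` of the Stirling numbers of the first kind is the
falling factorial. -/
theorem coeff_descPochhammer_eq_signedStirlingFirst (N r : ℕ) :
    (descPochhammer ℚ N).coeff r = (signedStirlingFirst N r : ℚ) := by
  induction N generalizing r with
  | zero =>
    cases r <;> simp [signedStirlingFirst, Polynomial.coeff_one]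
  | succ N ih =>
    rw [descPochhammer_succ_right, mul_sub, coeff_sub, ← C_eq_natCast, coeff_mul_C]
    cases r with
    | zero =>
      rw [mul_coeff_zero, coeff_X_zero, ih]
      cases N <;> simp [signedStirlingFirst]
    | succ r =>
      rw [coeff_mul_X, ih, ih]
      simp only [signedStirlingFirst, Nat.stirlingFirst_succ_succ]
      push_cast
      ring

open Polynomial in
/-- The even central factorial `∏_{i < M} (u - i²)`, as a polynomial in the square `u` of the
variable. -/
noncomputable def evenCentralFactorial (M : ℕ) : ℚ[X] :=
  ∏ i ∈ Finset.range M, (X - C ((i : ℚ) ^ 2))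

-- The roots 0, ..., 2M are shifted to -M, ..., M and pair up into X² - i²; the extra `X` doubles
-- the root 0. Each induction step adds the two outermost roots, one from each end.
open Polynomial in
theorem descPochhammer_comp_center (M : ℕ) :
    X * (descPochhammer ℚ (2 * M + 1)).comp (X + C (M : ℚ)) =
      expand ℚ 2 (evenCentralFactorial (M + 1)) := by
  induction M with
  | zero => simp [evenCentralFactorial, pow_two]
  | succ M ih =>
    rw [evenCentralFactorial, Finset.prod_range_succ, map_mul, ← evenCentralFactorial, ← ih,
      show 2 * (M + 1) + 1 = (2 * M + 1 + 1) + 1 by ring, descPochhammer_succ_left,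
      descPochhammer_succ_right (R := ℚ) (2 * M + 1)]
    have h : (X - 1 : ℚ[X]).comp (X + C ((M + 1 : ℕ) : ℚ)) = X + C (M : ℚ) := by
      simp only [sub_comp, X_comp, one_comp, Nat.cast_add, Nat.cast_one, map_add, map_one]
      ring
    rw [mul_comp, comp_assoc, h]
    simp only [mul_comp, sub_comp, X_comp, natCast_comp, map_sub, expand_X, expand_C]
    simp only [Nat.cast_add, Nat.cast_mul, Nat.cast_one, Nat.cast_ofNat, map_add, map_one,
      map_natCast, map_pow]
    ring

open Polynomial in
/-- `Q(2k, 2n)` is a central factorial number of the first kind. -/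
theorem Q_even_eq_coeff (k n : ℕ) (hk : 1 ≤ k) :
    Q (2 * k) (2 * n) = (evenCentralFactorial (k + n)).coeff k := by
  obtain ⟨k, rfl⟩ := Nat.exists_eq_add_of_le' hk
  have h := congrArg (fun p => p.coeff ((k + 1) * 2)) (descPochhammer_comp_center (k + n))
  simp only [coeff_expand_mul (show 0 < 2 by norm_num)] at h
  rw [show k + 1 + n = k + n + 1 by ring, ← h, show (k + 1) * 2 = (2 * k + 1) + 1 by ring,
    coeff_X_mul, comp_eq_sum_left, Polynomial.sum_over_range' _ (by simp) (2 * (k + n) + 2)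
      (by rw [descPochhammer_natDegree]; lia), finsetSum_coeff, Q]
  -- Powers of `X + C` below 2k+1 do not reach X^(2k+1); the other 2n+1 terms are those of `Q`.
  rw [show 2 * (k + n) + 2 = (2 * k + 1) + (2 * n + 1) by ring,
    Finset.sum_range_add _ (2 * k + 1) (2 * n + 1),
    Finset.sum_eq_zero (s := Finset.range (2 * k + 1)), zero_add]
  · refine Finset.sum_congr rfl fun l _ => ?_
    rw [coeff_C_mul, coeff_descPochhammer_eq_signedStirlingFirst, coeff_X_add_C_pow,
      show 2 * (k + 1) + l - 1 = 2 * k + 1 + l by lia,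
      show 2 * (k + 1) - 1 = 2 * k + 1 by lia,
      show 2 * (k + 1) + 2 * n - 1 = 2 * (k + n) + 1 by lia,
      Nat.add_sub_cancel_left]
    have hc : (((2 * (k + 1) : ℕ) : ℚ) + ((2 * n : ℕ) : ℚ) - 2) / 2 = ((k + n : ℕ) : ℚ) := by
      push_cast
      ring
    rw [hc]
    ring
  · intro r hr
    rw [coeff_C_mul, coeff_X_add_C_pow, Nat.choose_eq_zero_of_lt (Finset.mem_range.1 hr)]
    simp

theorem evenCentralFactorial_coeff_succ (M k : ℕ) :
    (evenCentralFactorial (M + 1)).coeff (k + 1) =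
      (evenCentralFactorial M).coeff k - (M : ℚ) ^ 2 * (evenCentralFactorial M).coeff (k + 1) := by
  rw [evenCentralFactorial, Finset.prod_range_succ, ← evenCentralFactorial, mul_sub,
    Polynomial.coeff_sub, Polynomial.coeff_mul_X, Polynomial.coeff_mul_C, mul_comm ((M : ℚ) ^ 2)]

theorem evenCentralFactorial_succ_coeff_zero (M : ℕ) :
    (evenCentralFactorial (M + 1)).coeff 0 = 0 := by
  rw [evenCentralFactorial, Finset.prod_range_succ', Polynomial.mul_coeff_zero]
  simp

/-! ### Powers of the squared arcsinh series -/

open PowerSeries in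
/-- The power series of `(2 arcsinh(√y / 2))² / y`. -/
noncomputable def arsinhSqDiv : PowerSeries ℚ :=
  mk fun n => 2 * (evenCentralFactorial (n + 1)).coeff 1 / ((2 * (n + 1)).factorial : ℚ)

theorem factorial_two_mul_succ (n : ℕ) :
    ((2 * (n + 1)).factorial : ℚ) = (2 * n + 2) * (2 * n + 1) * ((2 * n).factorial : ℚ) := by
  rw [show 2 * (n + 1) = 2 * n + 1 + 1 by ring, Nat.factorial_succ, Nat.factorial_succ]
  push_cast
  ring

open PowerSeries in
theorem constantCoeff_arsinhSqDiv : constantCoeff arsinhSqDiv = 1 := by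
  rw [← coeff_zero_eq_constantCoeff_apply, arsinhSqDiv, coeff_mk]
  norm_num [evenCentralFactorial]

open PowerSeries in
/-- The power series of `(2 arcsinh(√y / 2))²`. -/
noncomputable def arsinhSq : PowerSeries ℚ := X * arsinhSqDiv

open PowerSeries in
theorem coeff_arsinhSq (n : ℕ) :
    coeff n arsinhSq = 2 * (evenCentralFactorial n).coeff 1 / ((2 * n).factorial : ℚ) := by
  cases n with
  | zero => simp [arsinhSq, evenCentralFactorial, Polynomial.coeff_one]
  | succ n => rw [arsinhSq, coeff_succ_X_mul, arsinhSqDiv, coeff_mk]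

/-- The operator `4y(1 + y/4) ∂² + 2(1 + y/2) ∂`, which is `d²/dh²` in the coordinate
`h = 2 arcsinh(√y / 2)`. -/
noncomputable def arsinhOp (W : PowerSeries ℚ) : PowerSeries ℚ :=
  (4 * PowerSeries.X + PowerSeries.X ^ 2) *
      PowerSeries.derivative ℚ (PowerSeries.derivative ℚ W) +
    (2 + PowerSeries.X) * PowerSeries.derivative ℚ W

open PowerSeries in
theorem coeff_arsinhOp (W : PowerSeries ℚ) (n : ℕ) :
    coeff n (arsinhOp W) = (2 * n + 2) * (2 * n + 1) * coeff (n + 1) W + n ^ 2 * coeff n W := by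
  have h4 : (4 : PowerSeries ℚ) = C 4 := (map_ofNat C 4).symm
  have h2 : (2 : PowerSeries ℚ) = C 2 := (map_ofNat C 2).symm
  rw [arsinhOp, add_mul, add_mul, pow_two, h4, h2, mul_assoc, mul_assoc X X]
  simp only [map_add, coeff_C_mul]
  rcases n with _ | _ | n
  · simp [coeff_derivative]
  · simp only [zero_add, coeff_succ_X_mul, coeff_zero_X_mul, coeff_derivative]
    norm_num
    ring
  · simp only [coeff_succ_X_mul, coeff_derivative]
    push_cast
    ring

-- This is d²(h²)/dh² = 2, read off from the recurrence of the defining coefficients.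
open PowerSeries in
theorem arsinhOp_arsinhSq : arsinhOp arsinhSq = 2 := by
  ext n
  rw [coeff_arsinhOp, coeff_arsinhSq, coeff_arsinhSq, factorial_two_mul_succ,
    evenCentralFactorial_coeff_succ, show (2 : PowerSeries ℚ) = C 2 from (map_ofNat C 2).symm, coeff_C]
  have h : ((2 * n).factorial : ℚ) ≠ 0 := by positivity
  cases n with
  | zero => norm_num [evenCentralFactorial, Polynomial.coeff_one]
  | succ n =>
    rw [evenCentralFactorial_succ_coeff_zero, if_neg (Nat.succ_ne_zero n)]
    field_simp
    ring

-- First integral of the previous equation: in the coordinate h it says (dS/dh)² = 4S, because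
-- (dy/dh)² = 4y + y².
open PowerSeries in
theorem derivative_arsinhSq_sq :
    (4 * X + X ^ 2) * derivative ℚ arsinhSq ^ 2 = 4 * arsinhSq := by
  have h := arsinhOp_arsinhSq
  rw [arsinhOp] at h
  refine derivative.ext ?_ ?_
  · have h4 : derivative ℚ (4 : PowerSeries ℚ) = 0 := by
      rw [show (4 : PowerSeries ℚ) = C 4 from (map_ofNat C 4).symm, derivative_C]
    simp only [Derivation.leibniz, derivative_pow, map_add, h4, derivative_X, smul_eq_mul]
    push_cast
    linear_combination (2 * derivative ℚ arsinhSq) * h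
  · simp [arsinhSq]

open PowerSeries in
theorem arsinhOp_arsinhSq_pow (k : ℕ) :
    arsinhOp (arsinhSq ^ (k + 1)) = C ((2 * k + 2) * (2 * k + 1) : ℚ) * arsinhSq ^ k := by
  have h := arsinhOp_arsinhSq
  cases k with
  | zero => simp [h, map_ofNat]
  | succ k =>
    have h' := derivative_arsinhSq_sq
    have hd (j : ℕ) : derivative ℚ ((j : PowerSeries ℚ)) = 0 := by
      rw [← map_natCast (C (R := ℚ)), derivative_C]
    rw [arsinhOp] at h ⊢
    simp only [derivative_pow, Derivation.leibniz, hd, smul_eq_mul, Nat.add_sub_cancel]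
    simp only [Nat.cast_add, Nat.cast_one, map_add, map_mul, map_natCast, map_one, map_ofNat]
    linear_combination ((k + 2) * arsinhSq ^ (k + 1)) * h + ((k + 2) * (k + 1) * arsinhSq ^ k) * h'

-- The coefficient of y^n in `arsinhOp_arsinhSq_pow` is a recurrence in n that matches
-- `evenCentralFactorial_coeff_succ`.
open PowerSeries in
theorem coeff_arsinhSq_pow (k n : ℕ) :
    coeff n (arsinhSq ^ k) =
      ((2 * k).factorial : ℚ) * ((evenCentralFactorial n).coeff k / ((2 * n).factorial : ℚ)) := by
  induction n generalizing k with
  | zero =>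
    cases k <;> simp [arsinhSq, evenCentralFactorial, Polynomial.coeff_one, mul_pow]
  | succ n ih =>
    cases k with
    | zero => simp [evenCentralFactorial_succ_coeff_zero, coeff_one]
    | succ k =>
      have h := congrArg (coeff n) (arsinhOp_arsinhSq_pow k)
      rw [coeff_arsinhOp, coeff_C_mul, ih, ih] at h
      have h0 : ((2 * n).factorial : ℚ) ≠ 0 := by positivity
      have h1 : ((2 * n + 2) * (2 * n + 1) : ℚ) ≠ 0 := by positivity
      rw [factorial_two_mul_succ] at h ⊢
      rw [factorial_two_mul_succ, evenCentralFactorial_coeff_succ]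
      refine mul_left_cancel₀ h1 ?_
      rw [eq_sub_of_add_eq h]
      field_simp

open PowerSeries in
theorem Q_even_eq_coeff_arsinhSqDiv_pow (k n : ℕ) (hk : 1 ≤ k) :
    ((2 * k).factorial : ℚ) * (Q (2 * k) (2 * n) / ((2 * k + 2 * n).factorial : ℚ)) =
      coeff n (arsinhSqDiv ^ k) := by
  rw [Q_even_eq_coeff k n hk, ← mul_add, ← coeff_arsinhSq_pow, arsinhSq, mul_pow, add_comm k n,
    coeff_X_pow_mul]

/-! ### Newton interpolation in the exponent -/

open PowerSeries in
/-- Newton interpolation for the coefficients of the powers of a power series with constant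
coefficient `1`. -/
theorem coeff_pow_eq_newton {R : Type*} [CommRing R] (f : PowerSeries R) (hf : constantCoeff f = 1)
    (k n : ℕ) :
    coeff n (f ^ k) = ∑ j ∈ Finset.range (n + 1), (-1) ^ j * (k.choose j : R) *
      ∑ l ∈ Finset.range (j + 1), (-1) ^ l * (j.choose l : R) * coeff n (f ^ l) := by
  have inner (j : ℕ) : ∑ l ∈ Finset.range (j + 1), (-1) ^ l * (j.choose l : R) * coeff n (f ^ l) =
      coeff n ((1 - f) ^ j) := by
    rw [sub_eq_neg_add, add_pow, map_sum]
    refine Finset.sum_congr rfl fun l _ => ?_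
    rw [one_pow, mul_one, neg_pow f l, ← map_natCast (C (R := R)), coeff_mul_C,
      show (-1 : PowerSeries R) ^ l = C ((-1) ^ l) by simp, coeff_C_mul]
    ring
  have vanish (j : ℕ) (hj : n < j) : coeff n ((1 - f) ^ j) = 0 := by
    have hd : X ∣ (1 - f) := X_dvd_iff.2 (by simp [hf])
    exact X_pow_dvd_iff.1 (pow_dvd_pow_of_dvd hd j) n hj
  simp only [inner]
  have expansion : coeff n (f ^ k) = ∑ j ∈ Finset.range (k + 1),
      (-1) ^ j * (k.choose j : R) * coeff n ((1 - f) ^ j) := by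
    conv_lhs => rw [show f = -(1 - f) + 1 by ring, add_pow, map_sum]
    refine Finset.sum_congr rfl fun j _ => ?_
    rw [one_pow, mul_one, neg_pow (1 - f) j, ← map_natCast (C (R := R)), coeff_mul_C,
      show (-1 : PowerSeries R) ^ j = C ((-1) ^ j) by simp, coeff_C_mul]
    ring
  rw [expansion]
  -- The sums up to k and up to n both equal the sum up to k + n: the binomial vanishes beyond k,
  -- the coefficient beyond n.
  have extend (a : ℕ) (ha : a ≤ k + n) (h0 : ∀ j, a < j → (k.choose j : R) = 0 ∨ n < j) :
      ∑ j ∈ Finset.range (a + 1), (-1) ^ j * (k.choose j : R) * coeff n ((1 - f) ^ j) =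
      ∑ j ∈ Finset.range (k + n + 1), (-1) ^ j * (k.choose j : R) * coeff n ((1 - f) ^ j) := by
    refine Finset.sum_subset (Finset.range_mono (by lia)) fun j _ hj => ?_
    rcases h0 j (by simpa using hj) with h | h
    · simp [h]
    · simp [vanish j h]
  rw [extend k (by lia) fun j hj => Or.inl (by simp [Nat.choose_eq_zero_of_lt hj]),
    extend n (by lia) fun j hj => Or.inr hj]

theorem descPochhammer_eval_div_factorial (k j : ℕ) :
    (descPochhammer ℚ j).eval (k : ℚ) / (j.factorial : ℚ) = (k.choose j : ℚ) := by
  rw [descPochhammer_eval_eq_descFactorial, Nat.descFactorial_eq_factorial_mul_choose]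
  push_cast
  field_simp

theorem corollary5p1 (k n : ℕ) (hk : 1 ≤ k) (hn : 1 ≤ n) :
    ∑ j ∈ Finset.Icc 1 n,
        (-1 : ℚ) ^ j * ((descPochhammer ℚ j).eval (k : ℚ) / (j.factorial : ℚ)) *
          ∑ l ∈ Finset.Icc 1 j,
            (-1 : ℚ) ^ l * ((2 * l).factorial : ℚ) * (j.choose l : ℚ) *
              (Q (2 * l) (2 * n) / ((2 * l + 2 * n).factorial : ℚ)) =
      ((2 * k).factorial : ℚ) * (Q (2 * k) (2 * n) / ((2 * k + 2 * n).factorial : ℚ)) := by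
  have hn0 : n ≠ 0 := by lia
  have drop_zero (F : ℕ → ℚ) (m : ℕ) (h : F 0 = 0) :
      ∑ j ∈ Finset.range (m + 1), F j = ∑ j ∈ Finset.Icc 1 m, F j := by
    rw [Finset.range_eq_Ico, Finset.sum_eq_sum_Ico_succ_bot (Nat.succ_pos m), h, zero_add]
    rfl
  rw [Q_even_eq_coeff_arsinhSqDiv_pow k n hk,
    coeff_pow_eq_newton _ constantCoeff_arsinhSqDiv, drop_zero]
  · refine Finset.sum_congr rfl fun j _ => ?_
    rw [descPochhammer_eval_div_factorial, drop_zero]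
    · congr 1
      refine Finset.sum_congr rfl fun l hl => ?_
      rw [← Q_even_eq_coeff_arsinhSqDiv_pow l n (Finset.mem_Icc.1 hl).1]
      ring
    -- The zeroth terms involve only the coefficient of y^n in f^0 = 1, which is 0 as n ≥ 1.
    · simp [PowerSeries.coeff_one, hn0]
  · simp [PowerSeries.coeff_one, hn0]
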